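/- Let $\Gamma=\{z\in\mathbb C:|z|=1\}$ and let $C(\Gamma)$ be the set of continuous functions $\Gamma\to\mathbb C$. For $g\in C(\Gamma)$ and $n\in\mathbb Z$ put $\widehat g(n)=\frac1{2\pi}\int_{-\pi}^{\pi}g(e^{it})e^{-int}\,dt$. A weight on $\mathbb Z$ is a map $\omega:\mathbb Z\to[1,\infty)$ such that $\omega(m+n)\le\omega(m)\,\omega(n)$ for all $m,n\in\mathbb Z$. A function $g\in C(\Gamma)$ has $\omega$-absolutely convergent Fourier series ($\omega$-ACFS) if $\sum_{n\in\mathbb Z}|\widehat g(n)|\,\omega(n)<\infty$. **Theorem.** Let $\omega$ be a weight on $\mathbb Z$ and let $f\in C(\Gamma)$ have $\omega$-ACFS. (I) If $f(z)\neq0$ for all $z\in\Gamma$, then there exists a weight $\nu$ on $\mathbb Z$ such that: (a) $1/f$ has $\nu$-ACFS; (b) $\nu$ is non-constant if and only if $\omega$ is non-constant; (c) $\nu(n)\le\omega(n)$ for all $n\in\mathbb Z$. (II) Let $\varphi$ be a function holomorphic on a neighbourhood of the range of $f$. Then there exists a weight $\chi$ on $\mathbb Z$ such that: (a) $\varphi\circ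 f$ has $\chi$-ACFS; (b) $\chi$ is non-constant if and only if $\omega$ is non-constant; (c) $\chi(n)\le\omega(n)$ for all $n\in\mathbb Z$. -/

import Mathlib

/-- A weight on `ℤ`: a submultiplicative map `ω : ℤ → [1, ∞)`. -/
structure IsWeight (ω : ℤ → ℝ) : Prop where
  one_le : ∀ n, 1 ≤ ω n
  submul : ∀ m n, ω (m + n) ≤ ω m * ω n

/-- `ω` is a constant function. -/
def IsConstantWeight (ω : ℤ → ℝ) : Prop :=
  ∃ c : ℝ, ∀ n, ω n = c

/-- The `n`-th Fourier coefficient `(1 / 2π) ∫_{-π}^{π} g (e^{it}) e^{-int} dt` of a function `g` on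
the unit circle `Γ` of `ℂ`. It is the Fourier coefficient of the `2π`-periodic function
`t ↦ g (e^{it})`. -/
noncomputable def circleFourierCoeff (g : Circle → ℂ) (n : ℤ) : ℂ :=
  haveI : Fact (0 < 2 * Real.pi) := ⟨Real.two_pi_pos⟩
  fourierCoeff (fun t : AddCircle (2 * Real.pi) => g (AddCircle.toCircle t)) n

/-- `g` is a continuous function on the unit circle whose Fourier series is
`ω`-absolutely convergent: `∑ |ĝ(n)| ω(n) < ∞`. -/
structure HasACFS (ω : ℤ → ℝ) (g : Circle → ℂ) : Prop where
  continuous : Continuous g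
  summable : Summable fun n : ℤ => ‖circleFourierCoeff g n‖ * ω n

/-!
The logarithm of a weight is subadditive, so `1 + log ω` is again a weight. It is constant exactly
when `ω` is, it lies below `ω`, and it grows at most linearly. The point of passing to it is that,
unlike `ω`, it satisfies `∑ ν(n) q^|n| < ∞` for all `0 < q < 1`, hence the Wiener–Lévy theorem holds
for it.

For such `ν` and `φ` holomorphic near the range of `f`, approximate `f` in the norm `∑ |ĝ(n)| ν(n)`
by a partial sum `p` of its Fourier series and expand `φ` around `p`:
`φ ∘ f = ∑ₖ (f - p)ᵏ · (φ⁽ᵏ⁾ / k!) ∘ p`. Since `p` is a Laurent polynomial, the functions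
`(φ⁽ᵏ⁾ / k!) ∘ p` are holomorphic on an annulus independent of `k`. By Cauchy's estimates on that
annulus their Fourier coefficients decay geometrically, so their norms are finite, and they grow
slowly enough in `k` for the series to converge in norm.
-/

open AddCircle ENNReal Filter MeasureTheory Metric Real Set
open scoped Topology

local instance : Fact (0 < 2 * π) := ⟨two_pi_pos⟩

section FourierCoefficients

lemma fourier_eq_toCircle_zpow {T : ℝ} (n : ℤ) (t : AddCircle T) :
    fourier n t = (toCircle t : ℂ) ^ n := by
  rw [fourier_apply, toCircle_zsmul, Circle.coe_zpow]

lemma enorm_circle_zpow (z : Circle) (n : ℤ) : ‖(z : ℂ) ^ n‖ₑ = 1 := by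
  rw [← ofReal_norm, norm_zpow, Circle.norm_coe, one_zpow, ofReal_one]

lemma continuous_circle_zpow (n : ℤ) : Continuous fun z : Circle => (z : ℂ) ^ n :=
  continuous_subtype_val.zpow₀ n fun z => .inl (Circle.coe_ne_zero z)

lemma circleFourierCoeff_const_mul (c : ℂ) (g : Circle → ℂ) (n : ℤ) :
    circleFourierCoeff (fun z => c * g z) n = c * circleFourierCoeff g n :=
  fourierCoeff.const_mul _ c n

lemma circleFourierCoeff_zpow_mul (m : ℤ) (g : Circle → ℂ) (n : ℤ) :
    circleFourierCoeff (fun z => (z : ℂ) ^ m * g z) n = circleFourierCoeff g (n - m) := by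
  refine integral_congr_ae (.of_forall fun t => ?_)
  simp only [smul_eq_mul]
  rw [← fourier_eq_toCircle_zpow, neg_sub, sub_eq_neg_add, fourier_add, mul_assoc]

lemma circleFourierCoeff_zpow (m : ℤ) :
    circleFourierCoeff (fun z => (z : ℂ) ^ m) = Pi.single m 1 := by
  rw [← fourierCoeff_fourier (T := 2 * π) m]
  funext n
  simp only [circleFourierCoeff, ← fourier_eq_toCircle_zpow]

lemma integrable_fourier_mul_comp_toCircle {g : Circle → ℂ} (hg : Continuous g) (n : ℤ) :
    Integrable (fun t : AddCircle (2 * π) => fourier n t * g (toCircle t)) haarAddCircle :=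
  ((map_continuous (fourier n)).mul (hg.comp continuous_toCircle)).integrable_of_hasCompactSupport
    (.of_compactSpace _)

lemma hasSum_circleFourierCoeff {ι : Type*} [Countable ι] {g : ι → Circle → ℂ} {G : Circle → ℂ}
    {u : ι → ℝ} (hg : ∀ i, Continuous (g i)) (hu : Summable u) (hgu : ∀ i z, ‖g i z‖ ≤ u i)
    (hG : ∀ z, HasSum (fun i => g i z) (G z)) (n : ℤ) :
    HasSum (fun i => circleFourierCoeff (g i) n) (circleFourierCoeff G n) := by
  refine hasSum_integral_of_dominated_convergence (fun i _ => u i)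
    (fun i => (integrable_fourier_mul_comp_toCircle (hg i) _).aestronglyMeasurable)
    (fun i => .of_forall fun t => ?_) (.of_forall fun _ => hu) (integrable_const _)
    (.of_forall fun t => (hG _).mul_left _)
  rw [norm_smul, fourier_apply, Circle.norm_coe, one_mul]
  exact hgu i _

lemma hasSum_circleFourierCoeff_mul_zpow {g : Circle → ℂ} (hg : Continuous g)
    (hs : Summable fun n => ‖circleFourierCoeff g n‖) (z : Circle) :
    HasSum (fun n : ℤ => circleFourierCoeff g n * (z : ℂ) ^ n) (g z) := by
  obtain ⟨t, rfl⟩ := (homeomorphCircle two_pi_pos.ne').surjective z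
  rw [homeomorphCircle_apply]
  have h := has_pointwise_sum_fourier_series_of_summable
    (f := ⟨fun t : AddCircle (2 * π) => g (toCircle t), hg.comp continuous_toCircle⟩) hs.of_norm t
  simpa only [← fourier_eq_toCircle_zpow] using! h

end FourierCoefficients

section HolomorphicOnAnnulus

lemma circleAverage_eq_of_differentiableAt_annulus {E : Type*} [NormedAddCommGroup E]
    [NormedSpace ℂ E] [CompleteSpace E] {f : ℂ → E} {c : ℂ} {r R : ℝ} (hr : 0 < r) (hR : 0 < R)
    (hf : ∀ z, dist z c ∈ uIcc r R → DifferentiableAt ℂ f z) :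
    circleAverage f c r = circleAverage f c R := by
  wlog hle : r ≤ R generalizing r R
  · exact (this hR hr (uIcc_comm r R ▸ hf) (le_of_not_ge hle)).symm
  have hf' : ∀ z ∈ closedBall c R \ ball c r, DifferentiableAt ℂ f z := fun z hz =>
    hf z (uIcc_of_le hle ▸ ⟨not_lt.1 hz.2, hz.1⟩)
  rw [circleAverage_eq_circleIntegral hr.ne', circleAverage_eq_circleIntegral hR.ne',
    Complex.circleIntegral_sub_center_inv_smul_eq_of_differentiable_on_annulus_off_countable hr hle
      countable_empty (fun z hz => (hf' z hz).continuousAt.continuousWithinAt)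
      fun z hz => hf' z (sdiff_subset_sdiff ball_subset_closedBall ball_subset_closedBall hz.1)]

lemma norm_circleAverage_le {E : Type*} [NormedAddCommGroup E] [NormedSpace ℂ E]
    {f : ℂ → E} {c : ℂ} {R B : ℝ} (hR : 0 < R) (hf : ∀ z ∈ sphere c R, ‖f z‖ ≤ B) :
    ‖circleAverage f c R‖ ≤ B := by
  rw [circleAverage_eq_circleIntegral hR.ne']
  refine (circleIntegral.norm_two_pi_i_inv_smul_integral_le_of_norm_le_const hR.le
    (C := R⁻¹ * B) fun z hz => ?_).trans_eq (mul_inv_cancel_left₀ hR.ne' B)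
  rw [norm_smul, norm_inv, mem_sphere_iff_norm.1 hz]
  gcongr
  exact hf z hz

lemma circleFourierCoeff_eq_circleAverage (h : ℂ → ℂ) (n : ℤ) :
    circleFourierCoeff (fun z => h z) n = circleAverage (fun z => z ^ (-n) * h z) 0 1 := by
  have hcoeff : circleFourierCoeff (fun z => h z) n = _ := fourierCoeff_eq_intervalIntegral _ n 0
  have hcircle (θ : ℝ) : (toCircle (θ : AddCircle (2 * π)) : ℂ) = circleMap 0 1 θ := by
    rw [toCircle_apply_mk, div_self two_pi_pos.ne', one_mul, Circle.coe_exp, circleMap]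
    simp only [Complex.ofReal_one, one_mul, zero_add]
  simp only [hcoeff, circleAverage, zero_add, one_div, fourier_eq_toCircle_zpow, hcircle,
    smul_eq_mul]

lemma norm_circleFourierCoeff_le_zpow_mul {h : ℂ → ℂ} {R B : ℝ} (hR : 0 < R)
    (hd : ∀ z, ‖z‖ ∈ uIcc 1 R → DifferentiableAt ℂ h z) (hB : ∀ z, ‖z‖ = R → ‖h z‖ ≤ B) (n : ℤ) :
    ‖circleFourierCoeff (fun z => h z) n‖ ≤ R ^ (-n) * B := by
  rw [circleFourierCoeff_eq_circleAverage,
    circleAverage_eq_of_differentiableAt_annulus one_pos hR fun z hz => ?_]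
  · refine norm_circleAverage_le hR fun z hz => ?_
    have hz : ‖z‖ = R := mem_sphere_zero_iff_norm.1 hz
    rw [norm_mul, norm_zpow, hz]
    gcongr
    exact hB z hz
  · rw [dist_zero_right] at hz
    have hz0 : z ≠ 0 := norm_pos_iff.1 ((lt_min one_pos hR).trans_le hz.1)
    exact (differentiableAt_zpow.2 (.inl hz0)).mul (hd z hz)

lemma norm_circleFourierCoeff_le_pow_natAbs_mul {h : ℂ → ℂ} {ρ B : ℝ} (hρ : 0 < ρ) (hρ1 : ρ ≤ 1)
    (hd : ∀ z, ‖z‖ ∈ Icc ρ ρ⁻¹ → DifferentiableAt ℂ h z)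
    (hB : ∀ z, ‖z‖ ∈ Icc ρ ρ⁻¹ → ‖h z‖ ≤ B) (n : ℤ) :
    ‖circleFourierCoeff (fun z => h z) n‖ ≤ ρ ^ n.natAbs * B := by
  have hρ2 : 1 ≤ ρ⁻¹ := (one_le_inv₀ hρ).2 hρ1
  have hcoeff (R : ℝ) (hR : R ∈ Icc ρ ρ⁻¹) :
      ‖circleFourierCoeff (fun z => h z) n‖ ≤ R ^ (-n) * B :=
    norm_circleFourierCoeff_le_zpow_mul (hρ.trans_le hR.1)
      (fun z hz => hd z (uIcc_subset_Icc ⟨hρ1, hρ2⟩ hR hz)) (fun z hz => hB z (hz ▸ hR)) n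
  obtain hn | hn := le_total 0 n
  · convert! hcoeff ρ⁻¹ ⟨hρ1.trans hρ2, le_rfl⟩ using 2
    rw [inv_zpow', neg_neg, ← zpow_natCast, Int.natAbs_of_nonneg hn]
  · convert! hcoeff ρ ⟨le_rfl, hρ1.trans hρ2⟩ using 2
    rw [← zpow_natCast, Int.ofNat_natAbs_of_nonpos hn]

lemma exists_annulus_subset {E : Type*} [NormedAddCommGroup E] [NormedSpace ℝ E] [ProperSpace E]
    {V : Set E} (hV : IsOpen V) (hsphere : sphere 0 1 ⊆ V) :
    ∃ ρ ∈ Ioo (0 : ℝ) 1, ∀ z, ‖z‖ ∈ Icc ρ ρ⁻¹ → z ∈ V := by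
  have hdilate : ∀ᶠ t : ℝ in 𝓝 1, ∀ u ∈ sphere (0 : E) 1, t • u ∈ V :=
    (isCompact_sphere 0 1).eventually_forall_of_forall_eventually fun u hu =>
      (continuous_fst.smul continuous_snd).continuousAt.eventually_mem
        (hV.mem_nhds (by simpa using hsphere hu))
  have hIcc : Tendsto (fun ρ : ℝ => Icc ρ ρ⁻¹) (𝓝 1) (𝓝 1).smallSets :=
    tendsto_id.Icc (by simpa only [inv_one] using tendsto_inv₀ (one_ne_zero (α := ℝ)))
  obtain ⟨ρ, hρ, hρV⟩ := (((hIcc.eventually hdilate.smallSets).filter_mono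
    nhdsWithin_le_nhds).and (Ioo_mem_nhdsLT one_pos)).exists.imp fun _ => And.symm
  refine ⟨ρ, hρ, fun z hz => ?_⟩
  have hz0 : ‖z‖ ≠ 0 := (hρ.1.trans_le hz.1).ne'
  have hz1 : ‖z‖⁻¹ • z ∈ sphere (0 : E) 1 := by
    rw [mem_sphere_zero_iff_norm, norm_smul, norm_inv, norm_norm, inv_mul_cancel₀ hz0]
  simpa only [smul_inv_smul₀ hz0] using hρV _ hz _ hz1

end HolomorphicOnAnnulus

section TaylorCoefficients

variable {E : Type*} [NormedAddCommGroup E] [NormedSpace ℂ E]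

/-- The `k`-th Taylor coefficient of `φ` at `w`, as a function of the centre `w`. -/
noncomputable def taylorCoeff (φ : ℂ → E) (k : ℕ) (w : ℂ) : E :=
  (k.factorial : ℂ)⁻¹ • iteratedDeriv k φ w

variable [CompleteSpace E] {φ : ℂ → E} {U : Set ℂ}

lemma differentiableOn_taylorCoeff (hU : IsOpen U) (hφ : DifferentiableOn ℂ φ U) (k : ℕ) :
    DifferentiableOn ℂ (taylorCoeff φ k) U := by
  refine fun w hw => DifferentiableAt.differentiableWithinAt ?_
  simp only [funext fun w => taylorCoeff.eq_def φ k w, iteratedDeriv_eq_iterate]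
  exact ((hφ.analyticAt (hU.mem_nhds hw)).iterated_deriv k).differentiableAt.const_smul _

lemma hasSum_pow_smul_taylorCoeff {w y : ℂ} {r : ℝ} (hφ : DifferentiableOn ℂ φ (ball w r))
    (hy : y ∈ ball w r) : HasSum (fun k => (y - w) ^ k • taylorCoeff φ k w) (φ y) := by
  refine (Complex.hasSum_taylorSeries_on_ball hφ hy).congr_fun fun k => ?_
  rw [taylorCoeff, smul_comm]

lemma norm_taylorCoeff_le {w : ℂ} {r M : ℝ} (hr : 0 < r)
    (hφ : DifferentiableOn ℂ φ (closedBall w r)) (hM : ∀ y ∈ closedBall w r, ‖φ y‖ ≤ M) (k : ℕ) :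
    ‖taylorCoeff φ k w‖ ≤ M / r ^ k := by
  have hderiv := Complex.norm_iteratedDeriv_le_of_forall_mem_sphere_norm_le k hr
    (hφ.diffContOnCl_ball subset_rfl) fun y hy => hM y (sphere_subset_closedBall hy)
  rw [taylorCoeff, norm_smul, norm_inv, Complex.norm_natCast, inv_mul_le_iff₀ (by positivity),
    ← mul_div_assoc]
  exact hderiv

lemma exists_ball_subset_and_norm_taylorCoeff_le {K : Set ℂ} (hK : IsCompact K) (hU : IsOpen U)
    (hKU : K ⊆ U) (hφ : DifferentiableOn ℂ φ U) :
    ∃ δ > 0, ∃ M, ∀ w ∈ thickening δ K,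
      ball w δ ⊆ U ∧ ∀ k, ‖taylorCoeff φ k w‖ ≤ M / δ ^ k := by
  obtain ⟨ε, hε, hεU⟩ := hK.exists_cthickening_subset_open hU hKU
  obtain ⟨M, hM⟩ := hK.cthickening.exists_bound_of_continuousOn (hφ.continuousOn.mono hεU)
  have hball : ∀ w ∈ thickening (ε / 2) K, closedBall w (ε / 2) ⊆ cthickening ε K := by
    intro w hw y hy
    obtain ⟨x, hx, hwx⟩ := mem_thickening_iff.1 hw
    refine mem_cthickening_of_dist_le y x _ _ hx ((dist_triangle y w x).trans ?_)
    linarith [mem_closedBall.1 hy]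
  exact ⟨ε / 2, half_pos hε, M, fun w hw =>
    ⟨ball_subset_closedBall.trans ((hball w hw).trans hεU),
      norm_taylorCoeff_le (half_pos hε) (hφ.mono ((hball w hw).trans hεU))
        fun y hy => hM y (hball w hw hy)⟩⟩

end TaylorCoefficients

section WienerNorm

/-- The norm `∑ |ĝ(n)| ν(n)` of the Wiener algebra with weight `ν`. It takes values in `[0, ∞]`, so
that it makes sense for every `g`. -/
noncomputable def wienerNorm (ν : ℤ → ℝ) (g : Circle → ℂ) : ℝ≥0∞ :=
  ∑' n, ‖circleFourierCoeff g n‖ₑ * ENNReal.ofReal (ν n)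

variable {ν : ℤ → ℝ} {g h : Circle → ℂ}

lemma hasACFS_iff_wienerNorm_ne_top (hν : ∀ n, 0 ≤ ν n) :
    HasACFS ν g ↔ Continuous g ∧ wienerNorm ν g ≠ ∞ := by
  have hterm (n : ℤ) : ‖circleFourierCoeff g n‖ₑ * ENNReal.ofReal (ν n) =
      ENNReal.ofReal (‖circleFourierCoeff g n‖ * ν n) := by
    rw [ENNReal.ofReal_mul (norm_nonneg _), ofReal_norm]
  simp only [wienerNorm, hterm]
  refine ⟨fun hg => ⟨hg.continuous, hg.summable.tsum_ofReal_ne_top⟩, fun ⟨hg, hfin⟩ => ⟨hg, ?_⟩⟩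
  simpa only [ENNReal.toReal_ofReal (mul_nonneg (norm_nonneg _) (hν _))] using
    ENNReal.summable_toReal hfin

lemma HasACFS.mono {ω : ℤ → ℝ} (hν : ∀ n, 0 ≤ ν n) (hνω : ∀ n, ν n ≤ ω n) (hg : HasACFS ω g) :
    HasACFS ν g :=
  ⟨hg.continuous, .of_nonneg_of_le (fun n => mul_nonneg (norm_nonneg _) (hν n))
    (fun n => mul_le_mul_of_nonneg_left (hνω n) (norm_nonneg _)) hg.summable⟩

lemma HasACFS.hasSum_mul_zpow (hν : ∀ n, 1 ≤ ν n) (hg : HasACFS ν g) (z : Circle) :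
    HasSum (fun n : ℤ => circleFourierCoeff g n * (z : ℂ) ^ n) (g z) :=
  hasSum_circleFourierCoeff_mul_zpow hg.continuous
    (.of_nonneg_of_le (fun _ => norm_nonneg _)
      (fun n => le_mul_of_one_le_right (norm_nonneg _) (hν n)) hg.summable) z

lemma enorm_le_wienerNorm (hν : ∀ n, 1 ≤ ν n) (hg : Continuous g) (z : Circle) :
    ‖g z‖ₑ ≤ wienerNorm ν g := by
  by_cases hfin : wienerNorm ν g = ∞
  · exact hfin ▸ le_top
  have hgν : HasACFS ν g :=
    (hasACFS_iff_wienerNorm_ne_top fun n => zero_le_one.trans (hν n)).2 ⟨hg, hfin⟩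
  rw [← (hgν.hasSum_mul_zpow hν z).tsum_eq]
  refine enorm_tsum_le_tsum_enorm.trans (ENNReal.tsum_le_tsum fun n => ?_)
  rw [enorm_mul, enorm_circle_zpow]
  gcongr
  exact ENNReal.one_le_ofReal.2 (hν n)

section CountableSums

variable {ι : Type*} {s : ι → Circle → ℂ}

lemma norm_le_toReal_wienerNorm_of_tsum_ne_top (hν : ∀ n, 1 ≤ ν n) (hs : ∀ i, Continuous (s i))
    (hfin : ∑' i, wienerNorm ν (s i) ≠ ∞) (i : ι) (z : Circle) :
    ‖s i z‖ ≤ (wienerNorm ν (s i)).toReal := by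
  rw [← toReal_enorm]
  exact ENNReal.toReal_mono (ENNReal.ne_top_of_tsum_ne_top hfin i)
    (enorm_le_wienerNorm hν (hs i) z)

lemma wienerNorm_le_tsum [Countable ι] (hν : ∀ n, 1 ≤ ν n) (hs : ∀ i, Continuous (s i))
    (hg : ∀ z, HasSum (fun i => s i z) (g z)) : wienerNorm ν g ≤ ∑' i, wienerNorm ν (s i) := by
  by_cases hfin : ∑' i, wienerNorm ν (s i) = ∞
  · exact hfin ▸ le_top
  have hcoeff := hasSum_circleFourierCoeff hs (ENNReal.summable_toReal hfin)
    (norm_le_toReal_wienerNorm_of_tsum_ne_top hν hs hfin) hg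
  simp only [wienerNorm]
  rw [ENNReal.tsum_comm]
  refine ENNReal.tsum_le_tsum fun n => ?_
  rw [ENNReal.tsum_mul_right, ← (hcoeff n).tsum_eq]
  gcongr
  exact enorm_tsum_le_tsum_enorm

lemma HasACFS.of_hasSum [Countable ι] (hν : ∀ n, 1 ≤ ν n) (hs : ∀ i, Continuous (s i))
    (hfin : ∑' i, wienerNorm ν (s i) ≠ ∞) (hg : ∀ z, HasSum (fun i => s i z) (g z)) :
    HasACFS ν g := by
  refine (hasACFS_iff_wienerNorm_ne_top fun n => zero_le_one.trans (hν n)).2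
    ⟨?_, ne_top_of_le_ne_top hfin (wienerNorm_le_tsum hν hs hg)⟩
  rw [← funext fun z => (hg z).tsum_eq]
  exact continuous_tsum hs (ENNReal.summable_toReal hfin)
    (norm_le_toReal_wienerNorm_of_tsum_ne_top hν hs hfin)

end CountableSums

lemma wienerNorm_const_mul (ν : ℤ → ℝ) (c : ℂ) (g : Circle → ℂ) :
    wienerNorm ν (fun z => c * g z) = ‖c‖ₑ * wienerNorm ν g := by
  simp only [wienerNorm, circleFourierCoeff_const_mul, enorm_mul, mul_assoc, ENNReal.tsum_mul_left]

lemma wienerNorm_zpow (ν : ℤ → ℝ) (m : ℤ) :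
    wienerNorm ν (fun z => (z : ℂ) ^ m) = ENNReal.ofReal (ν m) := by
  rw [wienerNorm, circleFourierCoeff_zpow,
    tsum_eq_single m fun n hn => by rw [Pi.single_eq_of_ne hn, enorm_zero, zero_mul],
    Pi.single_eq_same, enorm_one, one_mul]

lemma wienerNorm_zpow_mul_le (hν : IsWeight ν) (m : ℤ) (g : Circle → ℂ) :
    wienerNorm ν (fun z => (z : ℂ) ^ m * g z) ≤ ENNReal.ofReal (ν m) * wienerNorm ν g := by
  simp only [wienerNorm, circleFourierCoeff_zpow_mul]
  rw [← (Equiv.addRight m).tsum_eq, ← ENNReal.tsum_mul_left]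
  refine ENNReal.tsum_le_tsum fun n => ?_
  rw [Equiv.coe_addRight, add_sub_cancel_right, mul_left_comm,
    ← ENNReal.ofReal_mul (zero_le_one.trans (hν.one_le m)), mul_comm (ν m)]
  gcongr
  exact hν.submul n m

lemma wienerNorm_mul_le (hν : IsWeight ν) (hg : HasACFS ν g) (hh : Continuous h) :
    wienerNorm ν (fun z => g z * h z) ≤ wienerNorm ν g * wienerNorm ν h := by
  have hexpand (z : Circle) :
      HasSum (fun m : ℤ => circleFourierCoeff g m * ((z : ℂ) ^ m * h z)) (g z * h z) := by
    simpa only [mul_assoc] using (hg.hasSum_mul_zpow hν.one_le z).mul_right (h z)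
  calc wienerNorm ν (fun z => g z * h z)
      ≤ ∑' m : ℤ, wienerNorm ν (fun z => circleFourierCoeff g m * ((z : ℂ) ^ m * h z)) :=
        wienerNorm_le_tsum hν.one_le
          (fun m => continuous_const.mul ((continuous_circle_zpow m).mul hh)) hexpand
    _ ≤ ∑' m : ℤ, ‖circleFourierCoeff g m‖ₑ * ENNReal.ofReal (ν m) * wienerNorm ν h := by
        refine ENNReal.tsum_le_tsum fun m => ?_
        rw [wienerNorm_const_mul, mul_assoc]
        gcongr
        exact wienerNorm_zpow_mul_le hν m h
    _ = wienerNorm ν g * wienerNorm ν h := ENNReal.tsum_mul_right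

lemma wienerNorm_pow_mul_le (hν : IsWeight ν) (hg : HasACFS ν g) (hh : Continuous h) (k : ℕ) :
    wienerNorm ν (fun z => g z ^ k * h z) ≤ wienerNorm ν g ^ k * wienerNorm ν h := by
  induction k with
  | zero => simp only [pow_zero, one_mul, le_refl]
  | succ k ih =>
    simp only [pow_succ', mul_assoc]
    exact (wienerNorm_mul_le hν hg ((hg.continuous.pow k).mul hh)).trans (mul_le_mul_right ih _)

end WienerNorm

section FourierPartialSum

/-- The partial sum over `s` of the Fourier series of `g`, as a Laurent polynomial defined on all
of `ℂ` rather than only on the circle. It takes a junk value at `0`. -/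
noncomputable def fourierPartialSum (g : Circle → ℂ) (s : Finset ℤ) (z : ℂ) : ℂ :=
  ∑ n ∈ s, circleFourierCoeff g n * z ^ n

lemma differentiableOn_fourierPartialSum (g : Circle → ℂ) (s : Finset ℤ) :
    DifferentiableOn ℂ (fourierPartialSum g s) {0}ᶜ := fun _ hz =>
  (DifferentiableAt.fun_sum fun _ _ =>
    (differentiableAt_zpow.2 (.inl hz)).const_mul _).differentiableWithinAt

lemma continuous_fourierPartialSum (g : Circle → ℂ) (s : Finset ℤ) :
    Continuous fun z : Circle => fourierPartialSum g s z :=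
  continuous_finsetSum s fun n _ => continuous_const.mul (continuous_circle_zpow n)

lemma tendsto_wienerNorm_sub_fourierPartialSum {ν : ℤ → ℝ} (hν : ∀ n, 1 ≤ ν n) {g : Circle → ℂ}
    (hg : HasACFS ν g) :
    Tendsto (fun s => wienerNorm ν fun z => g z - fourierPartialSum g s z) atTop (𝓝 0) := by
  have hfin := ((hasACFS_iff_wienerNorm_ne_top fun n => zero_le_one.trans (hν n)).1 hg).2
  refine tendsto_nhds_bot_mono' (ENNReal.tendsto_tsum_compl_atTop_zero hfin) fun s => ?_
  have hremainder (z : Circle) : HasSum (fun n : {n // n ∉ s} =>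
      circleFourierCoeff g n * (z : ℂ) ^ (n : ℤ)) (g z - fourierPartialSum g s z) :=
    (s.hasSum_compl_iff (f := fun n => circleFourierCoeff g n * (z : ℂ) ^ n)).2
      (by simpa only [fourierPartialSum, sub_add_cancel] using hg.hasSum_mul_zpow hν z)
  have hcont (n : {n // n ∉ s}) :
      Continuous fun z : Circle => circleFourierCoeff g n * (z : ℂ) ^ (n : ℤ) :=
    continuous_const.mul (continuous_circle_zpow n)
  refine (wienerNorm_le_tsum hν hcont hremainder).trans_eq ?_
  simp only [wienerNorm_const_mul, wienerNorm_zpow]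

lemma HasACFS.exists_differentiableOn_wienerNorm_sub_le {ν : ℤ → ℝ} (hν : ∀ n, 1 ≤ ν n)
    {g : Circle → ℂ} (hg : HasACFS ν g) {ε : ℝ} (hε : 0 < ε) :
    ∃ p : ℂ → ℂ, DifferentiableOn ℂ p {0}ᶜ ∧ HasACFS ν (fun z => g z - p z) ∧
      wienerNorm ν (fun z => g z - p z) ≤ ENNReal.ofReal ε := by
  obtain ⟨s, hs⟩ := ((tendsto_wienerNorm_sub_fourierPartialSum hν hg).eventually_le_const
    (ENNReal.ofReal_pos.2 hε)).exists
  have hcont : Continuous fun z : Circle => g z - fourierPartialSum g s z :=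
    hg.continuous.sub (continuous_fourierPartialSum g s)
  exact ⟨fourierPartialSum g s, differentiableOn_fourierPartialSum g s,
    (hasACFS_iff_wienerNorm_ne_top fun n => zero_le_one.trans (hν n)).2
      ⟨hcont, ne_top_of_le_ne_top ENNReal.ofReal_ne_top hs⟩, hs⟩

end FourierPartialSum

section WienerLevy

/-- `ν` grows more slowly than every exponential `q^(-|n|)` with `0 < q < 1`. Asking for summability
rather than for `ν(n) q^|n| → 0` gives the same notion and is the form in which it gets used. -/
def IsSubexponential (ν : ℤ → ℝ) : Prop :=
  ∀ q ∈ Ioo (0 : ℝ) 1, Summable fun n : ℤ => ν n * q ^ n.natAbs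

variable {ν : ℤ → ℝ} {f : Circle → ℂ}

lemma IsSubexponential.exists_wienerNorm_le (hsub : IsSubexponential ν) {V : Set ℂ}
    (hV : IsOpen V) (hsphere : sphere 0 1 ⊆ V) :
    ∃ C ≠ ∞, ∀ (h : ℂ → ℂ) (B : ℝ), DifferentiableOn ℂ h V → (∀ z ∈ V, ‖h z‖ ≤ B) →
      wienerNorm ν (fun z => h z) ≤ ENNReal.ofReal B * C := by
  obtain ⟨ρ, hρ, hρV⟩ := exists_annulus_subset hV hsphere
  refine ⟨_, (hsub ρ hρ).tsum_ofReal_ne_top, fun h B hd hB => ?_⟩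
  have hB0 : 0 ≤ B := (norm_nonneg _).trans (hB 1 (hsphere (by simp)))
  rw [← ENNReal.tsum_mul_left]
  refine ENNReal.tsum_le_tsum fun n => ?_
  have hdecay := norm_circleFourierCoeff_le_pow_natAbs_mul hρ.1 hρ.2.le
    (fun z hz => hd.differentiableAt (hV.mem_nhds (hρV z hz))) (fun z hz => hB z (hρV z hz)) n
  calc ‖circleFourierCoeff (fun z => h z) n‖ₑ * ENNReal.ofReal (ν n)
      ≤ ENNReal.ofReal (ρ ^ n.natAbs * B) * ENNReal.ofReal (ν n) := by
        rw [← ofReal_norm]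
        gcongr
    _ = ENNReal.ofReal B * ENNReal.ofReal (ν n * ρ ^ n.natAbs) := by
        have hρn : 0 ≤ ρ ^ n.natAbs := pow_nonneg hρ.1.le _
        rw [← ENNReal.ofReal_mul (mul_nonneg hρn hB0), ← ENNReal.ofReal_mul hB0]
        ring_nf

lemma HasACFS.of_hasSum_pow_mul (hν : IsWeight ν) {e : Circle → ℂ} {c : ℕ → Circle → ℂ}
    {r δ M : ℝ} {C : ℝ≥0∞} (he : HasACFS ν e) (hc : ∀ k, Continuous (c k)) (hr : 0 ≤ r)
    (hrδ : r < δ) (hC : C ≠ ∞) (he_norm : wienerNorm ν e ≤ ENNReal.ofReal r)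
    (hc_norm : ∀ k, wienerNorm ν (c k) ≤ ENNReal.ofReal (M / δ ^ k) * C)
    (hf : ∀ z, HasSum (fun k => e z ^ k * c k z) (f z)) : HasACFS ν f := by
  have hterm (k : ℕ) : wienerNorm ν (fun z => e z ^ k * c k z) ≤
      ENNReal.ofReal ((r / δ) ^ k * M) * C :=
    calc wienerNorm ν (fun z => e z ^ k * c k z)
        ≤ wienerNorm ν e ^ k * wienerNorm ν (c k) := wienerNorm_pow_mul_le hν he (hc k) k
      _ ≤ ENNReal.ofReal r ^ k * (ENNReal.ofReal (M / δ ^ k) * C) := by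
          gcongr
          exact hc_norm k
      _ = ENNReal.ofReal ((r / δ) ^ k * M) * C := by
          rw [← mul_assoc, ← ENNReal.ofReal_pow hr, ← ENNReal.ofReal_mul (pow_nonneg hr k),
            div_pow, div_mul_eq_mul_div, mul_div_assoc]
  have hgeom : Summable fun k : ℕ => (r / δ) ^ k * M :=
    (summable_geometric_of_lt_one (div_nonneg hr (hr.trans hrδ.le))
      ((div_lt_one (hr.trans_lt hrδ)).2 hrδ)).mul_right M
  refine .of_hasSum hν.one_le (fun k => (he.continuous.pow k).mul (hc k))
    (ne_top_of_le_ne_top ?_ (ENNReal.tsum_le_tsum hterm)) hf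
  rw [ENNReal.tsum_mul_right]
  exact ENNReal.mul_ne_top hgeom.tsum_ofReal_ne_top hC

theorem HasACFS.comp_of_isSubexponential (hν : IsWeight ν) (hsub : IsSubexponential ν)
    (hf : HasACFS ν f) {U : Set ℂ} {φ : ℂ → ℂ} (hU : IsOpen U) (hfU : range f ⊆ U)
    (hφ : DifferentiableOn ℂ φ U) : HasACFS ν (φ ∘ f) := by
  obtain ⟨δ, hδ, M, hM⟩ :=
    exists_ball_subset_and_norm_taylorCoeff_le (isCompact_range hf.continuous) hU hfU hφ
  have hthick : thickening δ (range f) ⊆ U := fun w hw => (hM w hw).1 (mem_ball_self hδ)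
  obtain ⟨p, hp, hfp, hfp_norm⟩ :=
    hf.exists_differentiableOn_wienerNorm_sub_le hν.one_le (half_pos hδ)
  have hdist (z : Circle) : dist (f z) (p z) < δ := by
    have hz := (enorm_le_wienerNorm hν.one_le hfp.continuous z).trans hfp_norm
    rw [← ofReal_norm, ENNReal.ofReal_le_ofReal_iff (half_pos hδ).le, ← dist_eq_norm] at hz
    exact hz.trans_lt (half_lt_self hδ)
  have hp_mem (z : Circle) : p z ∈ thickening δ (range f) :=
    mem_thickening_iff.2 ⟨f z, mem_range_self z, dist_comm (f z) _ ▸ hdist z⟩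
  let V : Set ℂ := {0}ᶜ ∩ p ⁻¹' thickening δ (range f)
  have hV : IsOpen V :=
    hp.continuousOn.isOpen_inter_preimage isOpen_compl_singleton isOpen_thickening
  have hcirc (z : Circle) : (z : ℂ) ∈ V := ⟨Circle.coe_ne_zero z, hp_mem z⟩
  have ha (k : ℕ) : DifferentiableOn ℂ (fun z => taylorCoeff φ k (p z)) V :=
    (differentiableOn_taylorCoeff hU hφ k).comp (hp.mono inter_subset_left)
      fun z hz => hthick hz.2
  obtain ⟨C, hC, hCV⟩ := hsub.exists_wienerNorm_le hV fun z hz => hcirc ⟨z, hz⟩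
  have hac (k : ℕ) : Continuous fun z : Circle => taylorCoeff φ k (p z) :=
    (ha k).continuousOn.comp_continuous continuous_subtype_val hcirc
  have ha_norm (k : ℕ) : wienerNorm ν (fun z => taylorCoeff φ k (p z)) ≤
      ENNReal.ofReal (M / δ ^ k) * C :=
    hCV (fun z => taylorCoeff φ k (p z)) (M / δ ^ k) (ha k) fun z hz => (hM (p z) hz.2).2 k
  have htaylor (z : Circle) :
      HasSum (fun k => (f z - p z) ^ k * taylorCoeff φ k (p z)) (φ (f z)) :=
    hasSum_pow_smul_taylorCoeff (hφ.mono (hM _ (hp_mem z)).1) (hdist z)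
  exact .of_hasSum_pow_mul hν hfp hac (half_pos hδ).le (half_lt_self hδ) hC hfp_norm ha_norm htaylor

theorem HasACFS.one_div_of_isSubexponential (hν : IsWeight ν) (hsub : IsSubexponential ν)
    (hf : HasACFS ν f) (hf0 : ∀ z, f z ≠ 0) : HasACFS ν fun z => 1 / f z :=
  hf.comp_of_isSubexponential (φ := fun w => 1 / w) hν hsub isOpen_compl_singleton
    (range_subset_iff.2 hf0) ((differentiableOn_const 1).div differentiableOn_id fun _ hw => hw)

end WienerLevy

section LogWeight

/-- The weight `1 + log ω`, which grows at most linearly. The summand `1` makes its values at least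
`1` and, for `x = log ω(m)` and `y = log ω(n)`, makes it submultiplicative:
`1 + x + y ≤ (1 + x) (1 + y)`. -/
noncomputable def logWeight (ω : ℤ → ℝ) (n : ℤ) : ℝ :=
  1 + log (ω n)

lemma IsWeight.pos {ω : ℤ → ℝ} (hω : IsWeight ω) (n : ℤ) : 0 < ω n :=
  one_pos.trans_le (hω.one_le n)

variable {ω : ℤ → ℝ} (hω : IsWeight ω)
include hω

lemma IsWeight.log_nonneg (n : ℤ) : 0 ≤ log (ω n) :=
  Real.log_nonneg (hω.one_le n)

lemma IsWeight.log_add_le (m n : ℤ) : log (ω (m + n)) ≤ log (ω m) + log (ω n) := by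
  rw [← log_mul (hω.pos m).ne' (hω.pos n).ne']
  exact log_le_log (hω.pos _) (hω.submul m n)

lemma IsWeight.isWeight_logWeight : IsWeight (logWeight ω) where
  one_le n := le_add_of_nonneg_right (hω.log_nonneg n)
  submul m n := by
    unfold logWeight
    nlinarith [hω.log_add_le m n, mul_nonneg (hω.log_nonneg m) (hω.log_nonneg n)]

lemma IsWeight.logWeight_le (n : ℤ) : logWeight ω n ≤ ω n := by
  unfold logWeight
  linarith [log_le_sub_one_of_pos (hω.pos n)]

lemma IsWeight.isConstantWeight_logWeight_iff :
    IsConstantWeight (logWeight ω) ↔ IsConstantWeight ω := by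
  refine ⟨fun ⟨c, hc⟩ => ⟨exp (c - 1), fun n => ?_⟩, fun ⟨c, hc⟩ => ⟨1 + log c, fun n => ?_⟩⟩
  · rw [← hc n, logWeight, add_sub_cancel_left, exp_log (hω.pos n)]
  · rw [logWeight, hc n]

lemma IsWeight.exists_log_le_add_natAbs_mul :
    ∃ A B : ℝ, ∀ n : ℤ, log (ω n) ≤ A + n.natAbs * B := by
  refine ⟨log (ω 0), log (ω 1) + log (ω (-1)), fun n => ?_⟩
  have h1 := hω.log_nonneg 1
  have hneg1 := hω.log_nonneg (-1)
  induction n using Int.induction_on with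
  | zero => simp
  | succ k ih =>
    rw [show ((k : ℤ) + 1).natAbs = k + 1 by lia]
    rw [Int.natAbs_natCast] at ih
    push_cast
    linarith [hω.log_add_le k 1]
  | pred k ih =>
    rw [sub_eq_add_neg, show (-(k : ℤ) + -1).natAbs = k + 1 by lia]
    rw [Int.natAbs_neg, Int.natAbs_natCast] at ih
    push_cast
    linarith [hω.log_add_le (-k) (-1)]

lemma IsWeight.isSubexponential_logWeight : IsSubexponential (logWeight ω) := by
  rintro q ⟨hq0, hq1⟩
  obtain ⟨A, B, hAB⟩ := hω.exists_log_le_add_natAbs_mul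
  have hnat : Summable fun k : ℕ => (1 + (A + k * B)) * q ^ k := by
    have hgeom := summable_geometric_of_lt_one hq0.le hq1
    have hlin := summable_pow_mul_geometric_of_norm_lt_one 1
      (show ‖q‖ < 1 by rwa [norm_of_nonneg hq0.le])
    refine ((hgeom.mul_left (1 + A)).add (hlin.mul_left B)).congr fun k => ?_
    ring
  have hint : Summable fun n : ℤ => (1 + (A + n.natAbs * B)) * q ^ n.natAbs :=
    .of_nat_of_neg (by simpa only [Int.natAbs_natCast] using hnat)
      (by simpa only [Int.natAbs_neg, Int.natAbs_natCast] using hnat)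
  refine hint.of_nonneg_of_le
    (fun n => mul_nonneg (hω.isWeight_logWeight.pos n).le (pow_nonneg hq0.le _)) fun n => ?_
  unfold logWeight
  gcongr
  exact hAB n

end LogWeight

theorem mainTheorem1_general (ω : ℤ → ℝ) (hω : IsWeight ω) :
    ∃ ν : ℤ → ℝ, IsWeight ν ∧ (¬ IsConstantWeight ν ↔ ¬ IsConstantWeight ω) ∧ (∀ n, ν n ≤ ω n) ∧
      ∀ f : Circle → ℂ, HasACFS ν f →
        ((∀ z, f z ≠ 0) → HasACFS ν (fun z => 1 / f z)) ∧
        ∀ (U : Set ℂ) (φ : ℂ → ℂ), IsOpen U → range f ⊆ U → DifferentiableOn ℂ φ U →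
          HasACFS ν (φ ∘ f) :=
  ⟨logWeight ω, hω.isWeight_logWeight, not_congr hω.isConstantWeight_logWeight_iff, hω.logWeight_le,
    fun _ hf => ⟨hf.one_div_of_isSubexponential hω.isWeight_logWeight hω.isSubexponential_logWeight,
      fun _ _ => hf.comp_of_isSubexponential hω.isWeight_logWeight hω.isSubexponential_logWeight⟩⟩

theorem mainTheorem1 (ω : ℤ → ℝ) (hω : IsWeight ω) (f : Circle → ℂ) (hf : HasACFS ω f) :
    ((∀ z, f z ≠ 0) →
      ∃ ν : ℤ → ℝ, IsWeight ν ∧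
        HasACFS ν (fun z => 1 / f z) ∧
        (¬ IsConstantWeight ν ↔ ¬ IsConstantWeight ω) ∧
        (∀ n, ν n ≤ ω n)) ∧
    (∀ (U : Set ℂ) (φ : ℂ → ℂ), IsOpen U → Set.range f ⊆ U → DifferentiableOn ℂ φ U →
      ∃ χ : ℤ → ℝ, IsWeight χ ∧
        HasACFS χ (φ ∘ f) ∧
        (¬ IsConstantWeight χ ↔ ¬ IsConstantWeight ω) ∧
        (∀ n, χ n ≤ ω n)) := by
  obtain ⟨ν, hν, hconst, hle, hclosed⟩ := mainTheorem1_general ω hω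
  obtain ⟨hinv, hcomp⟩ := hclosed f (hf.mono (fun n => (hν.pos n).le) hle)
  exact ⟨fun hf0 => ⟨ν, hν, hinv hf0, hconst, hle⟩,
    fun U φ hU hfU hφ => ⟨ν, hν, hcomp U φ hU hfU hφ, hconst, hle⟩⟩
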